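/- Let $d\ge 1$ and $m\ge 1$ be integers, $\theta\in(0,\pi/2)$, $c>0$, and put $C(\theta)=\dfrac{16(1+\sin\theta)^2m^2}{3\sin^2\theta}$. Let $\varphi:[0,\infty)\to[0,\infty)$ be continuous with $\varphi(s)=0$ for $s>1$ and $\varphi(s)>0$ for $0\le s<1/2$. Then there is a constant $C>0$, depending only on $d,m,\theta,c,\varphi$, such that the following holds. Let $\Omega\subset\mathbb R^d$ be compact and satisfy an interior cone condition with radius $r>0$ and angle $\theta$: for every $\mathbf x\in\Omega$ there is a unit vector $\boldsymbol\xi$ with $\mathbf x+t\mathbf y\in\Omega$ for all $0\le t\le r$ and all unit vectors $\mathbf y$ with $\mathbf y\cdot\boldsymbol\xi\ge\cos\theta$. Let $\Omega_h\subset\mathbb R^d$ be a finite set of points, $\mathbf x_i\in\Omega_h\cap\Omega$, $\varepsilon>0$, and let $$X=M_i=\Big\{\mathbf x_{ij}=\tfrac12(\mathbf x_i+\mathbf x_j)\ :\ \mathbf x_j\in\Omega_h,\ \mathbf x_j\neq\mathbf x_i,\ \|\mathbf x_j-\mathbf x_i\|<\varepsilon\Big\}$$ be the set of midpoints of the edges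 from $\mathbf x_i$ to its $\varepsilon$-neighbours. Assume that $X$ is nonempty and quasi-uniform, $q_X\le h_{X,\Omega}\le c\,q_X$, where $h_{X,\Omega}=\sup_{\mathbf x\in\Omega}\min_{\mathbf y\in X}\|\mathbf x-\mathbf y\|$ is the fill distance and $q_X=\frac12\min_{\mathbf x\ne\mathbf y\in X}\|\mathbf x-\mathbf y\|$ is the separation distance, and that $h_{X,\Omega}\le r/C(\theta)$. Let $\delta=2C(\theta)h_{X,\Omega}$, $\Phi(t)=\varphi(t/\delta)$ and $\Omega^*=\overline{\mathcal B(\mathbf x_i,\delta)}$. Let $\mathbf u$ be a vector field on $\mathbb R^d$ whose restriction to $\Omega^*$ is of class $C^{m+1}$, let $u_{i\to}(\mathbf x)=\mathbf u(\mathbf x)\cdot 2(\mathbf x-\mathbf x_i)$ be its radial component, and let $P_m^i$ be the space of polynomials of degree at most $m$ on $\mathbb R^d$ that vanish at $\mathbf x_i$. Then the weighted least-squares problem $$p^*=\operatorname*{arg\,min}_{p\in P^i_m}\ \sum_{\mathbf x_{ij}\in M_i}\big(u_{i\to}(\mathbf x_{ij})-p(\mathbf x_{ij})\big)^2\,\Phi(\|\mathbf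 x_i-\mathbf x_{ij}\|)$$ has exactly one solution $p^*$; the GMLS gradient and Laplacian of $u_{i\to}$ at $\mathbf x_i$ are $\widetilde\nabla u_{i\to}(\mathbf x_i)=\nabla p^*(\mathbf x_i)$ and $\widetilde\Delta u_{i\to}(\mathbf x_i)=\Delta p^*(\mathbf x_i)$ (the coefficients of $p^*$ being held fixed). The GMLS approximations $\widetilde{\mathbf u}(\mathbf x_i)=\frac12\widetilde\nabla u_{i\to}(\mathbf x_i)$ and $\widetilde{\nabla\cdot}\,\mathbf u(\mathbf x_i)=\frac14\widetilde\Delta u_{i\to}(\mathbf x_i)$ satisfy $$\|\mathbf u(\mathbf x_i)-\widetilde{\mathbf u}(\mathbf x_i)\|\le C\,h_{X,\Omega}^{m}\,\|\mathbf u\|_{C^{m+1}(\Omega^*)},\qquad |\nabla\cdot\mathbf u(\mathbf x_i)-\widetilde{\nabla\cdot}\,\mathbf u(\mathbf x_i)|\le C\,h_{X,\Omega}^{m-1}\,\|\mathbf u\|_{C^{m+1}(\Omega^*)},$$ where $\|\mathbf u\|_{C^{m+1}(\Omega^*)}=\max_{0\le k\le m+1}\sup_{\mathbf x\in\Omega^*}\|D^k\mathbf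 u(\mathbf x)\|$ with the operator norms of the $k$-linear maps $D^k\mathbf u(\mathbf x)$. -/

import Mathlib

noncomputable section

namespace StaggeredGMLS

/-- The Euclidean space `ℝ^d`. -/
abbrev Pt (d : ℕ) : Type := EuclideanSpace ℝ (Fin d)

/-! ### Regions, point sets, weights -/

/-- Interior cone condition with radius `r` and angle `θ`: every `x ∈ Ω` is the apex of a cone
`{x + t y : ‖y‖ = 1, ⟪y, ξ⟫ ≥ cos θ, 0 ≤ t ≤ r}` contained in `Ω`, for some unit vector `ξ`. -/
def InteriorCone {d : ℕ} (Ω : Set (Pt d)) (r θ : ℝ) : Prop :=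
  ∀ x ∈ Ω, ∃ ξ : Pt d, ‖ξ‖ = 1 ∧
    ∀ y : Pt d, ‖y‖ = 1 → Real.cos θ ≤ inner ℝ y ξ →
      ∀ t : ℝ, 0 ≤ t → t ≤ r → x + t • y ∈ Ω

/-- Fill distance `h_{X,Ω} = sup_{x ∈ Ω} min_{y ∈ X} ‖x - y‖` (used for nonempty `X`). -/
def fillDistance {d : ℕ} (X : Finset (Pt d)) (Ω : Set (Pt d)) : ℝ :=
  ⨆ x : Ω, Metric.infDist (x : Pt d) (X : Set (Pt d))

/-- Separation distance `q_X = (1/2) min_{x ≠ y ∈ X} ‖x - y‖`. -/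
def separationDistance {d : ℕ} (X : Finset (Pt d)) : ℝ :=
  (1 / 2) * sInf {s : ℝ | ∃ x ∈ X, ∃ y ∈ X, x ≠ y ∧ s = ‖x - y‖}

/-- `X` is quasi-uniform in `Ω` with constant `c`: `q_X ≤ h_{X,Ω} ≤ c q_X`. -/
def QuasiUniform {d : ℕ} (X : Finset (Pt d)) (Ω : Set (Pt d)) (c : ℝ) : Prop :=
  X.Nonempty ∧ separationDistance X ≤ fillDistance X Ω ∧
    fillDistance X Ω ≤ c * separationDistance X

/-- The constant `C(θ) = 16 (1 + sin θ)² m² / (3 sin² θ)`. -/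
def coneConst (m : ℕ) (θ : ℝ) : ℝ :=
  16 * (1 + Real.sin θ) ^ 2 * (m : ℝ) ^ 2 / (3 * Real.sin θ ^ 2)

/-- The radius `δ = 2 C(θ) h_{X,Ω}` of the support of the weight. -/
def supportRadius {d : ℕ} (m : ℕ) (θ : ℝ) (X : Finset (Pt d)) (Ω : Set (Pt d)) : ℝ :=
  2 * coneConst m θ * fillDistance X Ω

/-- Profile `φ` of a radial weight: continuous and nonnegative on `[0,∞)`, zero beyond `1`,
positive on `[0, 1/2)`. -/
structure IsWeightProfile (φ : ℝ → ℝ) : Prop where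
  continuousOn : ContinuousOn φ (Set.Ici 0)
  nonneg : ∀ s, 0 ≤ s → 0 ≤ φ s
  support : ∀ s, 1 < s → φ s = 0
  pos : ∀ s, 0 ≤ s → s < 1 / 2 → 0 < φ s

/-- The weight `Φ(t) = φ(t / δ)`: it vanishes for `t > δ` and is positive for `0 ≤ t < δ / 2`. -/
def scaledWeight (φ : ℝ → ℝ) (δ : ℝ) : ℝ → ℝ := fun t => φ (t / δ)

/-! ### The local grid -/

open Classical in
/-- The `ε`-neighbourhood of `x` in the discretization `nodes`. -/
def neighborhood {d : ℕ} (nodes : Finset (Pt d)) (ε : ℝ) (x : Pt d) : Finset (Pt d) :=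
  nodes.filter (fun y => ‖y - x‖ < ε)

open Classical in
/-- The midpoints `(x + y) / 2` of the edges from `x` to the other points `y` of its
`ε`-neighbourhood. -/
def midpoints {d : ℕ} (nodes : Finset (Pt d)) (ε : ℝ) (x : Pt d) : Finset (Pt d) :=
  ((neighborhood nodes ε x).erase x).image (fun y => (1 / 2 : ℝ) • (x + y))

/-! ### GMLS approximation with the polynomials that vanish at `x` -/

/-- `P_m^x`: polynomials of degree at most `m` that vanish at `x`. -/
def polySpace {d : ℕ} (m : ℕ) (x : Pt d) : Set (MvPolynomial (Fin d) ℝ) :=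
  {p | p.totalDegree ≤ m ∧ MvPolynomial.eval x.ofLp p = 0}

/-- The weighted least-squares functional `∑_{y ∈ X} (f(y) - p(y))² Φ(‖x - y‖)`. -/
def lsFunctional {d : ℕ} (Φ : ℝ → ℝ) (X : Finset (Pt d)) (x : Pt d) (f : Pt d → ℝ)
    (p : MvPolynomial (Fin d) ℝ) : ℝ :=
  ∑ y ∈ X, (f y - MvPolynomial.eval y.ofLp p) ^ 2 * Φ ‖x - y‖

/-- `p` is a minimizer over `P_m^x` of the weighted least-squares functional. -/
def IsGMLSFit {d : ℕ} (m : ℕ) (Φ : ℝ → ℝ) (X : Finset (Pt d)) (x : Pt d) (f : Pt d → ℝ)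
    (p : MvPolynomial (Fin d) ℝ) : Prop :=
  p ∈ polySpace m x ∧ ∀ q ∈ polySpace m x, lsFunctional Φ X x f p ≤ lsFunctional Φ X x f q

open Classical in
/-- The least-squares polynomial `p*` (a minimizer, if there is one, and `0` otherwise). -/
def gmlsFit {d : ℕ} (m : ℕ) (Φ : ℝ → ℝ) (X : Finset (Pt d)) (x : Pt d) (f : Pt d → ℝ) :
    MvPolynomial (Fin d) ℝ :=
  if h : ∃ p, IsGMLSFit m Φ X x f p then h.choose else 0

/-- GMLS gradient of `f` at `x`: with `p* = ∑ b_k p_k`, the vector `∑ b_k ∇p_k(x)`, that is, the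
gradient at `x` of the polynomial `p*` (whose coefficients are fixed numbers). -/
def gmlsGradient {d : ℕ} (m : ℕ) (Φ : ℝ → ℝ) (X : Finset (Pt d)) (x : Pt d) (f : Pt d → ℝ) :
    Pt d :=
  WithLp.toLp 2 fun k => MvPolynomial.eval x.ofLp (MvPolynomial.pderiv k (gmlsFit m Φ X x f))

/-- GMLS Laplacian of `f` at `x`: the number `∑ b_k Δp_k(x)`, the Laplacian of `p*` at `x`. -/
def gmlsLaplacian {d : ℕ} (m : ℕ) (Φ : ℝ → ℝ) (X : Finset (Pt d)) (x : Pt d) (f : Pt d → ℝ) :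
    ℝ :=
  ∑ k, MvPolynomial.eval x.ofLp
    (MvPolynomial.pderiv k (MvPolynomial.pderiv k (gmlsFit m Φ X x f)))

/-! ### Vector fields -/

/-- The radial component `y ↦ u(y) · 2 (y - x)` of the field `u` in the direction of `x`. -/
def radialComponent {d : ℕ} (u : Pt d → Pt d) (x : Pt d) : Pt d → ℝ :=
  fun y => inner ℝ (u y) ((2 : ℝ) • (y - x))

/-- GMLS approximation `(1/2) ∇̃ u_{x→}(x)` of `u(x)`. -/
def gmlsField {d : ℕ} (m : ℕ) (Φ : ℝ → ℝ) (X : Finset (Pt d)) (x : Pt d) (u : Pt d → Pt d) :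
    Pt d :=
  (1 / 2 : ℝ) • gmlsGradient m Φ X x (radialComponent u x)

/-- GMLS approximation `(1/4) Δ̃ u_{x→}(x)` of `∇·u(x)`. -/
def gmlsDivergence {d : ℕ} (m : ℕ) (Φ : ℝ → ℝ) (X : Finset (Pt d)) (x : Pt d)
    (u : Pt d → Pt d) : ℝ :=
  (1 / 4 : ℝ) * gmlsLaplacian m Φ X x (radialComponent u x)

/-- The divergence `∑_k ∂_k u_k(x)`. -/
def divergence {d : ℕ} (u : Pt d → Pt d) (x : Pt d) : ℝ :=
  ∑ k, (fderiv ℝ u x (EuclideanSpace.single k 1)).ofLp k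

/-- The norm of `C^n(S)`: the maximum over `j ≤ n` of the suprema over `S` of the norms of the
`j`-th derivatives. -/
def cNorm {d : ℕ} (n : ℕ) (S : Set (Pt d)) (u : Pt d → Pt d) : ℝ :=
  ⨆ j : Fin (n + 1), ⨆ x : S, ‖iteratedFDerivWithin ℝ (j : ℕ) u S (x : Pt d)‖

end StaggeredGMLS

end

/-!
On a line, the Chebyshev polynomials control a polynomial of degree at most `m` and its derivatives
at and beyond the endpoints of an interval on which it is bounded. In the cone at `x` this makes
the nodes of `X` near `x` a norming set for the polynomials of degree at most `m` on a ball of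
radius comparable to the fill distance `h`, and the bounds on that ball carry over to derivatives
at `x`. Since the least-squares fit is an orthogonal projection, it differs from any competitor `q`
at the nodes near `x` by at most a multiple of the error of `q`, with a factor that depends on the
number of nodes in the support of the weight, which quasi-uniformity bounds. The competitor is the
radial component of the Taylor polynomial of `u` of degree `m - 1`: it lies in `P_m^x`, has error
`O(h ^ (m + 1))`, and its pure derivatives at `x` are multiples of those of `u`. Each derivative of
the fit costs one factor `h`.
-/

namespace StaggeredGMLS

section Univariate

open Polynomial

theorem abs_eval_iterate_derivative_le {m : ℕ} {P : ℝ[X]} (hP : P.natDegree ≤ m) {M : ℝ}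
    (hM : ∀ t ∈ Set.Icc (-1 : ℝ) 1, |P.eval t| ≤ M) (k : ℕ) {s : ℝ} (hs : 1 ≤ s) :
    |(derivative^[k] P).eval s| ≤ (derivative^[k] (Chebyshev.T ℝ m)).eval s * M := by
  have hM0 : 0 ≤ M := (abs_nonneg _).trans (hM 0 (by simp))
  rcases hM0.eq_or_lt with rfl | hMpos
  · have hP0 : P = 0 := eq_zero_of_infinite_isRoot P <|
      (Set.Icc_infinite (by norm_num)).mono fun t ht => abs_nonpos_iff.1 (hM t ht)
    simp [hP0]
  have hscaled : ∀ σ : ℝ, |σ| = 1 → σ * (derivative^[k] P).eval s ≤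
      (derivative^[k] (Chebyshev.T ℝ m)).eval s * M := fun σ hσ => by
    have h := Chebyshev.eval_iterate_derivative_le_of_forall_abs_le_one (n := m) (k := k)
      (P := C (σ / M) * P) hs
      (degree_le_of_natDegree_le ((natDegree_C_mul_le _ _).trans hP)) fun t ht => by
        rw [eval_mul, eval_C, abs_mul, abs_div, hσ, abs_of_pos hMpos, one_div_mul_eq_div,
          div_le_one hMpos]
        exact hM t ht
    rwa [iterate_derivative_C_mul, eval_mul, eval_C, div_mul_eq_mul_div, div_le_iff₀ hMpos] at h
  exact abs_le'.2 ⟨by simpa using hscaled 1 (by simp), by simpa using hscaled (-1) (by simp)⟩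

theorem abs_eval_derivative_mul_sub_le {m : ℕ} {P : ℝ[X]} (hP : P.natDegree ≤ m) {a b M : ℝ}
    (hab : a ≤ b) (hM : ∀ t ∈ Set.Icc a b, |P.eval t| ≤ M) :
    |P.derivative.eval a| * (b - a) ≤ 2 * (m : ℝ) ^ 2 * M := by
  set Q : ℝ[X] := P.comp (C ((a + b) / 2) - C ((b - a) / 2) * X)
  have hQ : Q.natDegree ≤ m := natDegree_comp_le.trans <|
    (Nat.mul_le_mul hP (by compute_degree)).trans (mul_one m).le
  have hQM : ∀ t ∈ Set.Icc (-1 : ℝ) 1, |Q.eval t| ≤ M := fun t ht => by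
    simp only [Q, eval_comp, eval_sub, eval_mul, eval_C, eval_X]
    exact hM _ ⟨by nlinarith [ht.1, ht.2], by nlinarith [ht.1, ht.2]⟩
  have hQ' : Q.derivative.eval 1 = -((b - a) / 2 * P.derivative.eval a) := by
    simp only [Q, derivative_comp, derivative_sub, derivative_mul, derivative_C, derivative_X,
      eval_mul, eval_comp, eval_sub, eval_C, eval_X, zero_mul, zero_add, mul_one,
      zero_sub, neg_mul, eval_neg]
    ring_nf
  have hT' : (Chebyshev.T ℝ m).derivative.eval 1 = (m : ℝ) ^ 2 := by
    simp [Chebyshev.T_derivative_eq_U, Chebyshev.U_eval_one, sq]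
  have hmarkov := abs_eval_iterate_derivative_le hQ hQM 1 le_rfl
  rw [Function.iterate_one, hQ', hT', abs_neg, abs_mul, abs_of_nonneg (by linarith)] at hmarkov
  linarith

theorem abs_eval_one_sub_eval_zero_le {m : ℕ} (hm : 0 < m) {P : ℝ[X]} (hP : P.natDegree ≤ m)
    {b M : ℝ} (hb : 5 * (m : ℝ) ^ 2 ≤ b) (hM : ∀ t ∈ Set.Icc 0 b, |P.eval t| ≤ M) :
    |P.eval 1 - P.eval 0| ≤ M / 2 := by
  have hm1 : (1 : ℝ) ≤ (m : ℝ) ^ 2 := one_le_pow₀ (by exact_mod_cast hm)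
  have hderiv : ∀ t ∈ Set.Icc (0 : ℝ) 1, ‖P.derivative.eval t‖ ≤ M / 2 := fun t ht => by
    have hmarkov := abs_eval_derivative_mul_sub_le hP (a := t) (b := b) (by linarith [ht.2])
      fun s hs => hM s ⟨ht.1.trans hs.1, hs.2⟩
    have hlen : 4 * (m : ℝ) ^ 2 ≤ b - t := by linarith [ht.2]
    have := mul_le_mul_of_nonneg_left hlen (abs_nonneg (P.derivative.eval t))
    rw [Real.norm_eq_abs]
    nlinarith
  simpa using (convex_Icc (0 : ℝ) 1).norm_image_sub_le_of_norm_hasDerivWithin_le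
    (fun t _ => (P.hasDerivAt t).hasDerivWithinAt) hderiv
    (Set.left_mem_Icc.2 zero_le_one) (Set.right_mem_Icc.2 zero_le_one)

end Univariate

section LineRestriction

variable {σ R : Type*} [CommSemiring R]

/-- The polynomial `t ↦ p (x + t v)` in one variable. -/
noncomputable def lineRestriction (p : MvPolynomial σ R) (x v : σ → R) : Polynomial R :=
  MvPolynomial.aeval (fun i => Polynomial.C (x i) + Polynomial.C (v i) * Polynomial.X) p

@[simp]
theorem eval_lineRestriction (p : MvPolynomial σ R) (x v : σ → R) (t : R) :
    (lineRestriction p x v).eval t = MvPolynomial.eval (x + t • v) p := by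
  induction p using MvPolynomial.induction_on with
  | C a => simp [lineRestriction]
  | add p q hp hq => simp_all [lineRestriction]
  | mul_X p i hp => simp_all [lineRestriction, mul_comm t]

theorem natDegree_lineRestriction_le {m : ℕ} {p : MvPolynomial σ R} (hp : p.totalDegree ≤ m)
    (x v : σ → R) : (lineRestriction p x v).natDegree ≤ m :=
  (MvPolynomial.aeval_natDegree_le (n := 1) p hp _ fun _ => by compute_degree).trans
    (mul_one m).le

theorem derivative_lineRestriction_single [DecidableEq σ] (p : MvPolynomial σ R) (x : σ → R)
    (k : σ) (r : R) :
    (lineRestriction p x (Pi.single k r)).derivative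
      = Polynomial.C r * lineRestriction (MvPolynomial.pderiv k p) x (Pi.single k r) := by
  induction p using MvPolynomial.induction_on with
  | C a => simp [lineRestriction]
  | add p q hp hq => simp_all [lineRestriction, mul_add]
  | mul_X p i hp =>
    simp only [lineRestriction, map_mul, map_add, Polynomial.derivative_mul,
      Polynomial.derivative_C, Polynomial.derivative_X, Derivation.leibniz, smul_eq_mul,
      MvPolynomial.aeval_X, MvPolynomial.pderiv_X] at hp ⊢
    rw [hp]
    rcases eq_or_ne i k with rfl | hik
    · simp only [Pi.single_eq_same, map_one]
      ring
    · simp only [Pi.single_eq_of_ne hik, map_zero]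
      ring

theorem eval_iterate_derivative_lineRestriction_single [DecidableEq σ] (p : MvPolynomial σ R)
    (x : σ → R) (k : σ) (r t : R) (n : ℕ) :
    (Polynomial.derivative^[n] (lineRestriction p x (Pi.single k r))).eval t
      = r ^ n * MvPolynomial.eval (x + t • Pi.single k r) ((MvPolynomial.pderiv k)^[n] p) := by
  induction n generalizing p with
  | zero => simp
  | succ n ih =>
    rw [Function.iterate_succ_apply, Function.iterate_succ_apply,
      derivative_lineRestriction_single, Polynomial.iterate_derivative_C_mul, Polynomial.eval_mul,
      Polynomial.eval_C, ih, pow_succ', mul_assoc]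

theorem eval_iterate_pderiv [DecidableEq σ] (p : MvPolynomial σ R) (x : σ → R) (k : σ) (n : ℕ) :
    MvPolynomial.eval x ((MvPolynomial.pderiv k)^[n] p)
      = n.factorial * (lineRestriction p x (Pi.single k 1)).coeff n := by
  have h := eval_iterate_derivative_lineRestriction_single p x k 1 0 n
  rw [one_pow, one_mul, zero_smul, add_zero, ← Polynomial.coeff_zero_eq_eval_zero,
    Polynomial.coeff_iterate_derivative, zero_add, Nat.descFactorial_self, nsmul_eq_mul] at h
  exact h.symm

theorem eval_iterate_pderiv_eq_zero {p : MvPolynomial σ R} {n : ℕ} (hn : p.totalDegree < n)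
    (x : σ → R) (k : σ) : MvPolynomial.eval x ((MvPolynomial.pderiv k)^[n] p) = 0 := by
  classical
  rw [eval_iterate_pderiv, Polynomial.coeff_eq_zero_of_natDegree_lt
    ((natDegree_lineRestriction_le le_rfl _ _).trans_lt hn), mul_zero]

end LineRestriction

section PolynomialsOnBalls

variable {d m : ℕ} {p : MvPolynomial (Fin d) ℝ} {z : Pt d} {ρ M : ℝ}

theorem abs_eval_le_of_closedBall (hp : p.totalDegree ≤ m)
    (hM : ∀ y ∈ Metric.closedBall z ρ, |MvPolynomial.eval y.ofLp p| ≤ M) {T : ℝ} (hT : 1 ≤ T)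
    {y : Pt d} (hy : ‖y - z‖ ≤ T * ρ) :
    |MvPolynomial.eval y.ofLp p| ≤ (Polynomial.Chebyshev.T ℝ m).eval T * M := by
  have hT0 : 0 < T := by linarith
  set v : Pt d := T⁻¹ • (y - z)
  have hv : ‖v‖ ≤ ρ := by
    rwa [norm_smul, norm_inv, Real.norm_of_nonneg hT0.le, inv_mul_le_iff₀ hT0]
  have hline := abs_eval_iterate_derivative_le (natDegree_lineRestriction_le hp z.ofLp v.ofLp)
    (M := M) (fun t ht => by
      rw [eval_lineRestriction]
      refine hM (z + t • v) ?_
      rw [mem_closedBall_iff_norm, add_sub_cancel_left, norm_smul]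
      exact (mul_le_of_le_one_left (norm_nonneg v) (abs_le.2 ht)).trans hv) 0 hT
  have hy' : z + T • v = y := by simp [v, smul_smul, hT0.ne']
  rwa [Function.iterate_zero_apply, Function.iterate_zero_apply, eval_lineRestriction,
    ← WithLp.ofLp_smul, ← WithLp.ofLp_add, hy'] at hline

theorem pow_mul_abs_eval_iterate_pderiv_le (hp : p.totalDegree ≤ m)
    (hM : ∀ y ∈ Metric.closedBall z ρ, |MvPolynomial.eval y.ofLp p| ≤ M) {T : ℝ} (hT : 0 ≤ T)
    (hρ : 0 ≤ ρ) {x : Pt d} (hx : ‖x - z‖ ≤ T * ρ) (k : Fin d) (n : ℕ) :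
    (ρ / 2) ^ n * |MvPolynomial.eval x.ofLp ((MvPolynomial.pderiv k)^[n] p)|
      ≤ (Polynomial.derivative^[n] (Polynomial.Chebyshev.T ℝ m)).eval 1 *
        ((Polynomial.Chebyshev.T ℝ m).eval (T + 1) * M) := by
  set e : Pt d := EuclideanSpace.single k 1
  -- The line `t ↦ x + (1 - t) (ρ / 2) e` reaches `x` at the endpoint `t = 1`.
  have hline := abs_eval_iterate_derivative_le
    (natDegree_lineRestriction_le hp (x + (ρ / 2) • e).ofLp (Pi.single k (-(ρ / 2))))
    (M := (Polynomial.Chebyshev.T ℝ m).eval (T + 1) * M) (fun t ht => by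
      have hpt : (x + (ρ / 2) • e).ofLp + t • Pi.single k (-(ρ / 2))
          = (x + ((1 - t) * (ρ / 2)) • e).ofLp := by
        ext i
        rcases eq_or_ne i k with rfl | hik
        · simp only [WithLp.ofLp_add, WithLp.ofLp_smul, PiLp.ofLp_single, Pi.add_apply,
            Pi.smul_apply, Pi.single_eq_same, smul_eq_mul, mul_one, mul_neg, PiLp.add_apply,
            PiLp.smul_apply, PiLp.single_eq_same, e]
          ring
        · simp [e, hik]
      rw [eval_lineRestriction, hpt]
      refine abs_eval_le_of_closedBall hp hM (by linarith) ?_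
      rw [add_sub_right_comm]
      refine (norm_add_le _ _).trans ?_
      rw [norm_smul, PiLp.norm_single, norm_one, mul_one,
        Real.norm_of_nonneg (mul_nonneg (by linarith [ht.2]) (by linarith))]
      nlinarith [ht.1]) n le_rfl
  have hend : (x + (ρ / 2) • e).ofLp + (1 : ℝ) • Pi.single k (-(ρ / 2)) = x.ofLp := by
    ext i
    rcases eq_or_ne i k with rfl | hik
    · simp [e]
    · simp [e, hik]
  rwa [eval_iterate_derivative_lineRestriction_single, hend, abs_mul, abs_pow, abs_neg,
    abs_of_nonneg (by linarith)] at hline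

theorem eq_zero_of_eval_closedBall (hρ : 0 < ρ)
    (h : ∀ y ∈ Metric.closedBall z ρ, MvPolynomial.eval y.ofLp p = 0) : p = 0 := by
  refine MvPolynomial.funext fun y => ?_
  have hy : ‖WithLp.toLp 2 y - z‖ ≤ (1 + ‖WithLp.toLp 2 y - z‖ / ρ) * ρ := by
    rw [add_mul, div_mul_cancel₀ _ hρ.ne']
    linarith
  simpa using abs_eval_le_of_closedBall (M := 0) le_rfl (fun w hw => by rw [h w hw, abs_zero])
    (le_add_of_nonneg_right (by positivity)) hy

theorem add_smul_mem_closedBall {E : Type*} [SeminormedAddCommGroup E] [NormedSpace ℝ E]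
    {x y z : E} {ρ l t : ℝ} (hx : x ∈ Metric.closedBall z ρ)
    (hy : ‖y - (x + l • (z - x))‖ ≤ l * ρ) (ht : 0 ≤ t) (htl : t * l ≤ 1) :
    x + t • (y - x) ∈ Metric.closedBall z ρ := by
  rw [mem_closedBall_iff_norm] at hx ⊢
  calc ‖x + t • (y - x) - z‖ = ‖(1 - t * l) • (x - z) + t • (y - (x + l • (z - x)))‖ := by
        congr 1; module
    _ ≤ (1 - t * l) * ‖x - z‖ + t * ‖y - (x + l • (z - x))‖ := by
        refine (norm_add_le _ _).trans_eq ?_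
        rw [norm_smul, norm_smul, Real.norm_of_nonneg (by linarith), Real.norm_of_nonneg ht]
    _ ≤ (1 - t * l) * ρ + t * (l * ρ) := by gcongr
    _ = ρ := by ring

theorem continuous_eval_ofLp (p : MvPolynomial (Fin d) ℝ) :
    Continuous fun y : Pt d => MvPolynomial.eval y.ofLp p :=
  (MvPolynomial.continuous_eval p).comp (PiLp.continuous_ofLp 2 _)

/-- Starting from a point `x` where `|p|` is maximal, a nearby point of `X` towards the centre is
reached along a line on which Markov's inequality allows `p` to lose at most half of its value. -/
theorem abs_eval_le_two_mul_of_dense (hm : 0 < m) (hp : p.totalDegree ≤ m) {h B : ℝ} (hh : 0 < h)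
    (hρ : 5 * (m : ℝ) ^ 2 * h ≤ ρ) {X : Set (Pt d)}
    (hX : ∀ y ∈ Metric.closedBall z ρ, ∃ x ∈ X, ‖x - y‖ ≤ h)
    (hB : ∀ x ∈ X, x ∈ Metric.closedBall z ρ → |MvPolynomial.eval x.ofLp p| ≤ B) :
    ∀ y ∈ Metric.closedBall z ρ, |MvPolynomial.eval y.ofLp p| ≤ 2 * B := by
  have hm1 : (1 : ℝ) ≤ (m : ℝ) ^ 2 := one_le_pow₀ (by exact_mod_cast hm)
  have hρ0 : 0 < ρ := lt_of_lt_of_le (by positivity) hρ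
  obtain ⟨x, hx, hmax⟩ := (isCompact_closedBall z ρ).exists_isMaxOn
    ⟨z, Metric.mem_closedBall_self hρ0.le⟩ (continuous_eval_ofLp p).abs.continuousOn
  have hhρ : h ≤ ρ := by nlinarith
  obtain ⟨y, hyX, hy⟩ := hX (x + (h / ρ) • (z - x)) <| by
    exact add_smul_mem_closedBall (l := 1) hx (by simpa using hρ0.le) (by positivity)
      (by rwa [mul_one, div_le_one hρ0])
  have hline : ∀ t ∈ Set.Icc 0 (ρ / h), x + t • (y - x) ∈ Metric.closedBall z ρ := fun t ht =>
    add_smul_mem_closedBall hx (hy.trans_eq (div_mul_cancel₀ h hρ0.ne').symm) ht.1 <| by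
      rw [← mul_div_assoc, div_le_one hρ0, ← le_div_iff₀ hh]
      exact ht.2
  have hyB : |MvPolynomial.eval y.ofLp p| ≤ B := hB y hyX <| by
    simpa using hline 1 ⟨zero_le_one, (one_le_div hh).2 hhρ⟩
  have hdiff := abs_eval_one_sub_eval_zero_le hm
    (natDegree_lineRestriction_le hp x.ofLp (y - x).ofLp) ((le_div_iff₀ hh).2 hρ)
    fun t ht => (congrArg _ (eval_lineRestriction p _ _ t)).trans_le (hmax (hline t ht))
  have hx0 : x.ofLp + (0 : ℝ) • (y - x).ofLp = x.ofLp := by simp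
  have hy1 : x.ofLp + (1 : ℝ) • (y - x).ofLp = y.ofLp := by simp
  rw [eval_lineRestriction, eval_lineRestriction, hx0, hy1, abs_sub_comm] at hdiff
  intro w hw
  have hwx : |MvPolynomial.eval w.ofLp p| ≤ |MvPolynomial.eval x.ofLp p| := hmax hw
  have := abs_sub_abs_le_abs_sub (MvPolynomial.eval x.ofLp p) (MvPolynomial.eval y.ofLp p)
  linarith

end PolynomialsOnBalls

section Cones

theorem cos_mul_norm_le_inner {E : Type*} [NormedAddCommGroup E] [InnerProductSpace ℝ E]
    {v ξ : E} {a θ : ℝ} (hξ : ‖ξ‖ = 1) (ha : 0 < a) (hv : ‖v - a • ξ‖ ≤ a * Real.sin θ) :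
    Real.cos θ * ‖v‖ ≤ inner ℝ v ξ := by
  have hexpand : ‖v - a • ξ‖ ^ 2 = ‖v‖ ^ 2 - 2 * a * inner ℝ v ξ + a ^ 2 := by
    rw [norm_sub_sq_real, inner_smul_right, norm_smul, hξ, Real.norm_of_nonneg ha.le]
    ring
  have hsq : ‖v - a • ξ‖ ^ 2 ≤ (a * Real.sin θ) ^ 2 := pow_le_pow_left₀ (norm_nonneg _) hv 2
  refine le_of_mul_le_mul_left ?_ (mul_pos two_pos ha)
  nlinarith [sq_nonneg (‖v‖ - a * Real.cos θ), Real.sin_sq_add_cos_sq θ]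

variable {d : ℕ} {Ω : Set (Pt d)} {r θ : ℝ} {x : Pt d}

theorem InteriorCone.exists_forall_mem (hΩ : InteriorCone Ω r θ) (hx : x ∈ Ω) :
    ∃ ξ : Pt d, ‖ξ‖ = 1 ∧
      ∀ w, ‖w - x‖ ≤ r → Real.cos θ * ‖w - x‖ ≤ inner ℝ (w - x) ξ → w ∈ Ω := by
  obtain ⟨ξ, hξ, hcone⟩ := hΩ x hx
  refine ⟨ξ, hξ, fun w hw hangle => ?_⟩
  rcases eq_or_ne w x with rfl | hne
  · exact hx
  have hpos : 0 < ‖w - x‖ := norm_pos_iff.2 (sub_ne_zero.2 hne)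
  have hmem := hcone (‖w - x‖⁻¹ • (w - x)) (norm_smul_inv_norm (𝕜 := ℝ) (norm_pos_iff.1 hpos)) (by
    rwa [real_inner_smul_left, le_inv_mul_iff₀ hpos, mul_comm]) ‖w - x‖ hpos.le hw
  rwa [smul_smul, mul_inv_cancel₀ hpos.ne', one_smul, add_sub_cancel] at hmem

theorem InteriorCone.infinite (hΩ : InteriorCone Ω r θ) (hr : 0 < r) (hx : x ∈ Ω) :
    Ω.Infinite := by
  obtain ⟨ξ, hξ, hcone⟩ := hΩ x hx
  have hinj : Function.Injective fun t : ℝ => x + t • ξ := fun s t hst =>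
    smul_left_injective ℝ (norm_ne_zero_iff.1 (hξ ▸ one_ne_zero)) (add_left_cancel hst)
  refine ((Set.Icc_infinite hr).image hinj.injOn).mono ?_
  rintro _ ⟨t, ht, rfl⟩
  exact hcone ξ hξ (by simpa [hξ] using Real.cos_le_one θ) t ht.1 ht.2

theorem InteriorCone.exists_closedBall_subset (hΩ : InteriorCone Ω r θ) (hx : x ∈ Ω)
    (hθ : 0 < Real.sin θ) {R : ℝ} (hR : 0 < R) (hRr : R ≤ r) :
    ∃ z : Pt d, ‖x - z‖ = R / (1 + Real.sin θ) ∧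
      Metric.closedBall z (R * Real.sin θ / (1 + Real.sin θ)) ⊆ Ω ∩ Metric.closedBall x R := by
  obtain ⟨ξ, hξ, hcone⟩ := hΩ.exists_forall_mem hx
  set a := R / (1 + Real.sin θ) with ha
  have ha0 : 0 < a := by positivity
  have hnorm : ‖a • ξ‖ = a := by rw [norm_smul, hξ, mul_one, Real.norm_of_nonneg ha0.le]
  refine ⟨x + a • ξ, by rw [sub_add_cancel_left, norm_neg, hnorm], fun w hw => ?_⟩
  have hwa : ‖w - x - a • ξ‖ ≤ a * Real.sin θ := by
    rwa [mem_closedBall_iff_norm, ← sub_sub, mul_div_right_comm] at hw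
  have hwR : ‖w - x‖ ≤ R := by
    calc ‖w - x‖ ≤ ‖w - x - a • ξ‖ + ‖a • ξ‖ := norm_le_norm_sub_add _ _
      _ ≤ a * Real.sin θ + a := add_le_add hwa hnorm.le
      _ = R := by rw [ha]; field_simp; ring
  exact ⟨hcone w (hwR.trans hRr) (cos_mul_norm_le_inner hξ ha0 hwa),
    mem_closedBall_iff_norm.2 hwR⟩

end Cones

section FillDistance

variable {d m : ℕ} {X : Finset (Pt d)} {Ω : Set (Pt d)} {θ r : ℝ} {x : Pt d}

theorem separationDistance_nonneg (X : Finset (Pt d)) : 0 ≤ separationDistance X := by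
  refine mul_nonneg (by norm_num) (Real.sInf_nonneg ?_)
  rintro _ ⟨_, _, _, _, _, rfl⟩
  exact norm_nonneg _

theorem two_mul_separationDistance_le {y z : Pt d} (hy : y ∈ X) (hz : z ∈ X) (hyz : y ≠ z) :
    2 * separationDistance X ≤ ‖y - z‖ := by
  rw [separationDistance, ← mul_assoc, mul_one_div_cancel two_ne_zero, one_mul]
  refine csInf_le ⟨0, ?_⟩ ⟨y, hy, z, hz, hyz, rfl⟩
  rintro _ ⟨_, _, _, _, _, rfl⟩
  exact norm_nonneg _

theorem exists_norm_sub_le_fillDistance (hΩ : Bornology.IsBounded Ω) (hX : X.Nonempty)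
    (hx : x ∈ Ω) : ∃ y ∈ X, ‖y - x‖ ≤ fillDistance X Ω := by
  obtain ⟨y₀, hy₀⟩ := hX
  obtain ⟨R, hR⟩ := hΩ.subset_closedBall y₀
  have hbdd : BddAbove (Set.range fun w : Ω => Metric.infDist (w : Pt d) (X : Set (Pt d))) := by
    refine ⟨R, ?_⟩
    rintro _ ⟨w, rfl⟩
    exact (Metric.infDist_le_dist_of_mem hy₀).trans (hR w.2)
  obtain ⟨y, hy, hdist⟩ := X.finite_toSet.isCompact.exists_infDist_eq_dist ⟨y₀, hy₀⟩ x
  refine ⟨y, hy, ?_⟩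
  rw [← dist_eq_norm, dist_comm, ← hdist]
  exact le_ciSup hbdd ⟨x, hx⟩

theorem fillDistance_pos (hΩ : Bornology.IsBounded Ω) (hΩ' : Ω.Infinite) (hX : X.Nonempty) :
    0 < fillDistance X Ω := by
  by_contra! hle
  refine hΩ' (X.finite_toSet.subset fun w hw => ?_)
  obtain ⟨y, hy, hd⟩ := exists_norm_sub_le_fillDistance hΩ hX hw
  rwa [← sub_eq_zero.1 (norm_le_zero_iff.1 (hd.trans hle))]

theorem exists_card_le_of_subset_closedBall {E : Type*} [NormedAddCommGroup E] [NormedSpace ℝ E]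
    [ProperSpace E] (K : ℝ) {s : ℝ} (hs : 0 < s) :
    ∃ n : ℕ, ∀ (X : Finset E) (x : E) (h : ℝ), 0 < h → (X : Set E) ⊆ Metric.closedBall x (K * h) →
      (∀ y ∈ X, ∀ z ∈ X, y ≠ z → s * h ≤ ‖y - z‖) → X.card ≤ n := by
  obtain ⟨t, ht, hcover⟩ := Metric.totallyBounded_iff.1
    (isCompact_closedBall (0 : E) K).totallyBounded (s / 2) (half_pos hs)
  refine ⟨ht.toFinset.card, fun X x h hh hX hsep => ?_⟩
  have hnear : ∀ y ∈ X, ∃ a ∈ t, dist (h⁻¹ • (y - x)) a < s / 2 := fun y hy => by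
    have hy' : h⁻¹ • (y - x) ∈ Metric.closedBall (0 : E) K := by
      rw [mem_closedBall_zero_iff, norm_smul, norm_inv, Real.norm_of_nonneg hh.le,
        inv_mul_le_iff₀ hh, mul_comm, ← mem_closedBall_iff_norm]
      exact hX hy
    simpa using hcover hy'
  choose! g hgt hg using hnear
  refine Finset.card_le_card_of_injOn g (fun y hy => ht.mem_toFinset.2 (hgt y hy))
    fun y hy z hz hyz => ?_
  by_contra hne
  have hlt : dist (h⁻¹ • (y - x)) (h⁻¹ • (z - x)) < s := by
    linarith [dist_triangle_right (h⁻¹ • (y - x)) (h⁻¹ • (z - x)) (g y), hg y hy, hyz ▸ hg z hz]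
  rw [dist_eq_norm, ← smul_sub, sub_sub_sub_cancel_right, norm_smul, norm_inv,
    Real.norm_of_nonneg hh.le, inv_mul_lt_iff₀ hh] at hlt
  linarith [hsep y hy z hz hne]

theorem coneConst_pos (hm : 0 < m) (hθ : 0 < Real.sin θ) : 0 < coneConst m θ := by
  have : (0 : ℝ) < m := by exact_mod_cast hm
  rw [coneConst]
  positivity

/-- The radius, in units of `h_{X,Ω}`, of the ball inscribed in a cone of angle `θ` and height
`C(θ) h_{X,Ω} / 2`. At the nodes in a cone of this height the weight has a positive lower bound. -/
noncomputable def normingRatio (m : ℕ) (θ : ℝ) : ℝ :=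
  coneConst m θ * Real.sin θ / (2 * (1 + Real.sin θ))

theorem five_mul_sq_le_normingRatio (m : ℕ) (hθ : 0 < Real.sin θ) :
    5 * (m : ℝ) ^ 2 ≤ normingRatio m θ := by
  have hcancel : normingRatio m θ = 8 * (1 + Real.sin θ) * (m : ℝ) ^ 2 / (3 * Real.sin θ) := by
    rw [normingRatio, coneConst]
    field_simp
    ring
  rw [hcancel, le_div_iff₀ (by positivity)]
  nlinarith [sq_nonneg (m : ℝ), mul_le_mul_of_nonneg_left (Real.sin_le_one θ) (sq_nonneg (m : ℝ))]

theorem normingRatio_pos (hm : 0 < m) (hθ : 0 < Real.sin θ) : 0 < normingRatio m θ :=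
  lt_of_lt_of_le (by positivity) (five_mul_sq_le_normingRatio m hθ)

theorem InteriorCone.exists_norming_closedBall (hcone : InteriorCone Ω r θ) (hm : 0 < m)
    (hθ : 0 < Real.sin θ) (hΩ : Bornology.IsBounded Ω) (hx : x ∈ Ω) (hX : X.Nonempty)
    (hpos : 0 < fillDistance X Ω) (hr : fillDistance X Ω ≤ r / coneConst m θ) :
    ∃ z : Pt d, ‖x - z‖ ≤ (Real.sin θ)⁻¹ * (normingRatio m θ * fillDistance X Ω) ∧
      ∀ (p : MvPolynomial (Fin d) ℝ) (B : ℝ), p.totalDegree ≤ m →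
        (∀ y ∈ X, ‖x - y‖ ≤ supportRadius m θ X Ω / 4 → |MvPolynomial.eval y.ofLp p| ≤ B) →
        ∀ y ∈ Metric.closedBall z (normingRatio m θ * fillDistance X Ω),
          |MvPolynomial.eval y.ofLp p| ≤ 2 * B := by
  have hC := coneConst_pos hm hθ
  rw [le_div_iff₀' hC] at hr
  have hCh := mul_pos hC hpos
  obtain ⟨z, hxz, hball⟩ := hcone.exists_closedBall_subset hx hθ
    (R := supportRadius m θ X Ω / 4) (by rw [supportRadius]; linarith)
    (by rw [supportRadius]; linarith)
  have hradius : supportRadius m θ X Ω / 4 * Real.sin θ / (1 + Real.sin θ)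
      = normingRatio m θ * fillDistance X Ω := by
    rw [supportRadius, normingRatio]
    field_simp
    ring
  rw [hradius] at hball
  refine ⟨z, ?_, fun p B hp hB => ?_⟩
  · refine hxz.le.trans_eq ?_
    rw [← hradius]
    field_simp
  · refine abs_eval_le_two_mul_of_dense hm hp hpos
      (mul_le_mul_of_nonneg_right (five_mul_sq_le_normingRatio m hθ) hpos.le) (X := X)
      (fun y hy => exists_norm_sub_le_fillDistance hΩ hX (hball hy).1) fun y hyX hy => hB y hyX ?_
    rw [norm_sub_rev, ← mem_closedBall_iff_norm]
    exact (hball hy).2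

end FillDistance

section Taylor

variable {E F : Type*} [NormedAddCommGroup E] [NormedSpace ℝ E] [NormedAddCommGroup F]
  [NormedSpace ℝ F] {u : E → F} {S : Set E} {n : ℕ} {x v : E}

theorem iteratedDerivWithin_comp_add_smul (hS : UniqueDiffOn ℝ S) (hu : ContDiffOn ℝ n u S)
    {I : Set ℝ} (hI : UniqueDiffOn ℝ I) (hv : ∀ t ∈ I, x + t • v ∈ S) {t : ℝ} (ht : t ∈ I) :
    iteratedDerivWithin n (fun t => u (x + t • v)) I t
      = iteratedFDerivWithin ℝ n u S (x + t • v) fun _ => v := by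
  induction n generalizing t with
  | zero => simp
  | succ n ih =>
    have ih' : ∀ s ∈ I, _ := fun s hs => ih (hu.of_le (by exact_mod_cast n.le_succ)) hs
    have hline : HasDerivWithinAt (fun t : ℝ => x + t • v) v I t := by
      simpa using ((hasDerivAt_id t).smul_const v).const_add x |>.hasDerivWithinAt
    have hderiv := ((hu.differentiableOn_iteratedFDerivWithin
      (by exact_mod_cast n.lt_succ_self) hS _ (hv t ht)).hasFDerivWithinAt.comp_hasDerivWithinAt t
        hline hv)
    have happly := (ContinuousMultilinearMap.apply ℝ (fun _ : Fin n => E) F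
      fun _ => v).hasFDerivAt.comp_hasDerivWithinAt t hderiv
    rw [iteratedDerivWithin_succ, derivWithin_congr ih' (ih' t ht),
      iteratedFDerivWithin_succ_apply_left]
    exact happly.derivWithin (hI t ht)

theorem norm_sub_taylor_le (hn : 0 < n) (hS : UniqueDiffOn ℝ S) (hu : ContDiffOn ℝ n u S)
    (hv : ∀ t ∈ Set.Icc (0 : ℝ) 1, x + t • v ∈ S) {N : ℝ}
    (hN : ∀ z ∈ S, ‖iteratedFDerivWithin ℝ n u S z‖ ≤ N) :
    ‖u (x + v) - ∑ j ∈ Finset.range n,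
      (j.factorial : ℝ)⁻¹ • iteratedFDerivWithin ℝ j u S x fun _ => v‖ ≤ N * ‖v‖ ^ n := by
  obtain ⟨n, rfl⟩ := Nat.exists_eq_add_one.2 hn
  have h01 : UniqueDiffOn ℝ (Set.Icc (0 : ℝ) 1) := uniqueDiffOn_Icc zero_lt_one
  have hline : ContDiff ℝ (n + 1 : ℕ) fun t : ℝ => x + t • v := by fun_prop
  have hx : x ∈ S := by simpa using hv 0 (Set.left_mem_Icc.2 zero_le_one)
  have hN0 : 0 ≤ N := (norm_nonneg _).trans (hN x hx)
  have hcomp : ContDiffOn ℝ (n + 1) (fun t : ℝ => u (x + t • v)) (Set.Icc 0 1) := by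
    exact_mod_cast hu.comp hline.contDiffOn hv
  have hremainder := taylor_mean_remainder_bound (C := N * ‖v‖ ^ (n + 1)) zero_le_one hcomp
    (Set.right_mem_Icc.2 zero_le_one) fun t ht => by
      rw [iteratedDerivWithin_comp_add_smul hS hu h01 hv ht]
      refine (ContinuousMultilinearMap.le_opNorm _ _).trans ?_
      rw [Finset.prod_const, Finset.card_univ, Fintype.card_fin]
      exact mul_le_mul_of_nonneg_right (hN _ (hv t ht)) (by positivity)
  have hpoly : taylorWithinEval (fun t : ℝ => u (x + t • v)) n (Set.Icc 0 1) 0 1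
      = ∑ j ∈ Finset.range (n + 1),
        (j.factorial : ℝ)⁻¹ • iteratedFDerivWithin ℝ j u S x fun _ => v := by
    rw [taylor_within_apply]
    refine Finset.sum_congr rfl fun j hj => ?_
    rw [iteratedDerivWithin_comp_add_smul hS
      (hu.of_le (by exact_mod_cast (Finset.mem_range.1 hj).le)) h01 hv
      (Set.left_mem_Icc.2 zero_le_one)]
    simp only [sub_zero, one_pow, mul_one, zero_smul, add_zero]
  rw [hpoly] at hremainder
  simp only [one_smul, sub_zero, one_pow, mul_one] at hremainder
  exact hremainder.trans (div_le_self (by positivity) (by exact_mod_cast n.factorial_pos))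

theorem uniqueDiffOn_closedBall {δ : ℝ} (hδ : 0 < δ) :
    UniqueDiffOn ℝ (Metric.closedBall x δ) :=
  uniqueDiffOn_convex (convex_closedBall x δ)
    ⟨x, Metric.ball_subset_interior_closedBall (Metric.mem_ball_self hδ)⟩

theorem iteratedFDerivWithin_one_closedBall {δ : ℝ} (hδ : 0 < δ) :
    iteratedFDerivWithin ℝ 1 u (Metric.closedBall x δ) x (fun _ => v) = fderiv ℝ u x v := by
  rw [iteratedFDerivWithin_one_apply
    (uniqueDiffOn_closedBall hδ x (Metric.mem_closedBall_self hδ.le)),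
    fderivWithin_of_mem_nhds (Metric.closedBall_mem_nhds x hδ)]

end Taylor

theorem norm_iteratedFDerivWithin_le_cNorm {d n : ℕ} {S : Set (Pt d)} (hS : IsCompact S)
    (hS' : UniqueDiffOn ℝ S) {u : Pt d → Pt d} (hu : ContDiffOn ℝ n u S) {j : ℕ} (hj : j ≤ n)
    {x : Pt d} (hx : x ∈ S) : ‖iteratedFDerivWithin ℝ j u S x‖ ≤ cNorm n S u := by
  have hbdd : BddAbove (Set.range fun x : S => ‖iteratedFDerivWithin ℝ j u S (x : Pt d)‖) := by
    have := hS.bddAbove_image (f := fun x => ‖iteratedFDerivWithin ℝ j u S x‖)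
      (hu.continuousOn_iteratedFDerivWithin (by exact_mod_cast hj) hS').norm
    rwa [Set.image_eq_range] at this
  refine (le_ciSup hbdd ⟨x, hx⟩).trans ?_
  exact le_ciSup (f := fun j : Fin (n + 1) =>
    ⨆ x : S, ‖iteratedFDerivWithin ℝ (j : ℕ) u S (x : Pt d)‖) (Set.finite_range _).bddAbove
    ⟨j, Nat.lt_succ_of_le hj⟩

section TaylorPolynomial

variable {d : ℕ}

/-- The `i`-th component of the polynomial map `y ↦ A (y - x, …, y - x)`. -/
noncomputable def diagonalPoly {n : ℕ}
    (A : ContinuousMultilinearMap ℝ (fun _ : Fin n => Pt d) (Pt d)) (x : Pt d) (i : Fin d) :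
    MvPolynomial (Fin d) ℝ :=
  ∑ r : Fin n → Fin d, MvPolynomial.C (A (fun j => EuclideanSpace.single (r j) 1) i) *
    ∏ j, (MvPolynomial.X (r j) - MvPolynomial.C (x (r j)))

theorem totalDegree_X_sub_C_le {σ R : Type*} [CommRing R] [Nontrivial R] (i : σ) (a : R) :
    (MvPolynomial.X i - MvPolynomial.C a : MvPolynomial σ R).totalDegree ≤ 1 :=
  (MvPolynomial.totalDegree_sub_C_le _ _).trans (MvPolynomial.totalDegree_X i).le

section

variable {n : ℕ} (A : ContinuousMultilinearMap ℝ (fun _ : Fin n => Pt d) (Pt d))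

theorem totalDegree_diagonalPoly_le (x : Pt d) (i : Fin d) :
    (diagonalPoly A x i).totalDegree ≤ n := by
  refine MvPolynomial.totalDegree_finsetSum_le fun r _ => ?_
  refine (MvPolynomial.totalDegree_mul _ _).trans ?_
  rw [MvPolynomial.totalDegree_C, zero_add]
  refine (MvPolynomial.totalDegree_finsetProd _ _).trans ?_
  refine (Finset.sum_le_card_nsmul _ _ 1 fun j _ => totalDegree_X_sub_C_le _ _).trans ?_
  simp

theorem eval_diagonalPoly (x y : Pt d) (i : Fin d) :
    MvPolynomial.eval y.ofLp (diagonalPoly A x i) = A (fun _ => y - x) i := by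
  have hexpand : y - x = ∑ k, (y k - x k) • EuclideanSpace.single k (1 : ℝ) := by
    ext i
    simp [Pi.single_apply]
  conv_rhs => rw [hexpand]
  rw [← ContinuousMultilinearMap.coe_coe, MultilinearMap.map_sum]
  simp [diagonalPoly, MultilinearMap.map_smul_univ, mul_comm]

end

/-- The product of the Taylor polynomial of `u` at `x` of degree `m - 1`, taken along `S`, with
`2 (y - x)`: the natural element of `P_m^x` to compare with `radialComponent u x`. -/
noncomputable def radialTaylorPoly (m : ℕ) (S : Set (Pt d)) (u : Pt d → Pt d) (x : Pt d) :
    MvPolynomial (Fin d) ℝ :=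
  ∑ j ∈ Finset.range m, ∑ i, MvPolynomial.C (2 * (j.factorial : ℝ)⁻¹) *
    (diagonalPoly (iteratedFDerivWithin ℝ j u S x) x i *
      (MvPolynomial.X i - MvPolynomial.C (x i)))

variable {m : ℕ} {S : Set (Pt d)} {u : Pt d → Pt d} {x : Pt d}

theorem eval_radialTaylorPoly (y : Pt d) :
    MvPolynomial.eval y.ofLp (radialTaylorPoly m S u x)
      = inner ℝ (∑ j ∈ Finset.range m,
          (j.factorial : ℝ)⁻¹ • iteratedFDerivWithin ℝ j u S x fun _ => y - x)
        ((2 : ℝ) • (y - x)) := by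
  rw [sum_inner, radialTaylorPoly, map_sum]
  refine Finset.sum_congr rfl fun j _ => ?_
  rw [PiLp.inner_apply, map_sum]
  refine Finset.sum_congr rfl fun i _ => ?_
  simp only [map_mul, map_sub, MvPolynomial.eval_C, MvPolynomial.eval_X, eval_diagonalPoly,
    PiLp.smul_apply, PiLp.sub_apply, smul_eq_mul, RCLike.inner_apply, conj_trivial]
  ring

theorem radialTaylorPoly_mem_polySpace : radialTaylorPoly m S u x ∈ polySpace m x := by
  refine ⟨?_, by rw [eval_radialTaylorPoly, sub_self, smul_zero, inner_zero_right]⟩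
  refine MvPolynomial.totalDegree_finsetSum_le fun j hj =>
    MvPolynomial.totalDegree_finsetSum_le fun i _ => ?_
  calc _ ≤ 0 + (j + 1) := (MvPolynomial.totalDegree_mul _ _).trans <|
        add_le_add (MvPolynomial.totalDegree_C _).le <| (MvPolynomial.totalDegree_mul _ _).trans <|
          add_le_add (totalDegree_diagonalPoly_le _ _ _) (totalDegree_X_sub_C_le _ _)
    _ ≤ m := by simpa using Finset.mem_range.1 hj

theorem lineRestriction_radialTaylorPoly (k : Fin d) :
    lineRestriction (radialTaylorPoly m S u x) x.ofLp (Pi.single k 1)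
      = ∑ j ∈ Finset.range m, Polynomial.C (2 * (j.factorial : ℝ)⁻¹ *
        iteratedFDerivWithin ℝ j u S x (fun _ => EuclideanSpace.single k 1) k) *
          Polynomial.X ^ (j + 1) := by
  refine Polynomial.funext fun t => ?_
  rw [eval_lineRestriction,
    show x.ofLp + t • Pi.single k 1 = (x + t • EuclideanSpace.single k 1).ofLp from rfl,
    eval_radialTaylorPoly, sum_inner, Polynomial.eval_finsetSum]
  refine Finset.sum_congr rfl fun j _ => ?_
  rw [add_sub_cancel_left, ContinuousMultilinearMap.map_smul_univ _ (fun _ => t)]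
  simp only [Finset.prod_const, Finset.card_univ, Fintype.card_fin, real_inner_smul_right,
    EuclideanSpace.inner_single_right, Polynomial.eval_mul, Polynomial.eval_C,
    Polynomial.eval_pow, Polynomial.eval_X, PiLp.smul_apply, smul_eq_mul, conj_trivial, one_mul]
  ring

theorem eval_iterate_pderiv_radialTaylorPoly {j : ℕ} (hj : j < m) (k : Fin d) :
    MvPolynomial.eval x.ofLp ((MvPolynomial.pderiv k)^[j + 1] (radialTaylorPoly m S u x))
      = 2 * (j + 1) * iteratedFDerivWithin ℝ j u S x (fun _ => EuclideanSpace.single k 1) k := by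
  rw [eval_iterate_pderiv, lineRestriction_radialTaylorPoly, Polynomial.finsetSum_coeff,
    Finset.sum_eq_single_of_mem j (Finset.mem_range.2 hj) fun i _ hij => by
      rw [Polynomial.coeff_C_mul_X_pow, if_neg (by omega)],
    Polynomial.coeff_C_mul_X_pow, if_pos rfl, Nat.factorial_succ]
  push_cast
  field_simp

theorem abs_radialComponent_sub_radialTaylorPoly_le (hm : 0 < m) {δ N : ℝ} (hδ : 0 < δ)
    (hu : ContDiffOn ℝ m u (Metric.closedBall x δ))
    (hN : ∀ z ∈ Metric.closedBall x δ,
      ‖iteratedFDerivWithin ℝ m u (Metric.closedBall x δ) z‖ ≤ N)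
    {y : Pt d} (hy : y ∈ Metric.closedBall x δ) :
    |radialComponent u x y
        - MvPolynomial.eval y.ofLp (radialTaylorPoly m (Metric.closedBall x δ) u x)|
      ≤ 2 * N * δ ^ (m + 1) := by
  have hyx : ‖y - x‖ ≤ δ := mem_closedBall_iff_norm.1 hy
  have hN0 : 0 ≤ N := (norm_nonneg _).trans (hN y hy)
  have htaylor := norm_sub_taylor_le hm (uniqueDiffOn_closedBall hδ) hu (v := y - x)
    (fun t ht => (convex_closedBall x δ).add_smul_sub_mem (Metric.mem_closedBall_self hδ.le) hy ht)
    hN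
  rw [add_sub_cancel] at htaylor
  rw [eval_radialTaylorPoly, radialComponent, ← inner_sub_left, ← Real.norm_eq_abs]
  calc _ ≤ _ * ‖(2 : ℝ) • (y - x)‖ := norm_inner_le_norm _ _
    _ ≤ N * ‖y - x‖ ^ m * ‖(2 : ℝ) • (y - x)‖ := by gcongr
    _ = 2 * N * ‖y - x‖ ^ (m + 1) := by
      rw [norm_smul, Real.norm_of_nonneg zero_le_two]
      ring
    _ ≤ 2 * N * δ ^ (m + 1) := by gcongr

end TaylorPolynomial

section LeastSquares

variable {d m : ℕ} {Φ : ℝ → ℝ} {X : Finset (Pt d)} {x y : Pt d} {f : Pt d → ℝ}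
  {p q : MvPolynomial (Fin d) ℝ}

/-- `P_m^x` as a subspace of the polynomial ring. -/
noncomputable def polySubmodule (m : ℕ) (x : Pt d) : Submodule ℝ (MvPolynomial (Fin d) ℝ) :=
  MvPolynomial.restrictTotalDegree (Fin d) ℝ m ⊓
    LinearMap.ker (MvPolynomial.aeval x.ofLp : MvPolynomial (Fin d) ℝ →ₐ[ℝ] ℝ).toLinearMap

theorem mem_polySubmodule : p ∈ polySubmodule m x ↔ p ∈ polySpace m x := by
  simp [polySubmodule, polySpace, MvPolynomial.mem_restrictTotalDegree, MvPolynomial.aeval_eq_eval]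

theorem sub_mem_polySpace (hp : p ∈ polySpace m x) (hq : q ∈ polySpace m x) :
    p - q ∈ polySpace m x :=
  mem_polySubmodule.1 (sub_mem (mem_polySubmodule.2 hp) (mem_polySubmodule.2 hq))

/-- The values of a function on `X`, scaled so that `lsFunctional` becomes a squared distance in
`ℓ²(X)`. -/
noncomputable def weightedSample (Φ : ℝ → ℝ) (X : Finset (Pt d)) (x : Pt d) :
    (Pt d → ℝ) →ₗ[ℝ] EuclideanSpace ℝ X :=
  (WithLp.linearEquiv 2 ℝ (X → ℝ)).symm.toLinearMap ∘ₗ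
    LinearMap.pi fun y => √(Φ ‖x - y‖) • LinearMap.proj (y : Pt d)

/-- The linear map that sends a polynomial to its function. -/
noncomputable def polyFun : MvPolynomial (Fin d) ℝ →ₗ[ℝ] Pt d → ℝ :=
  LinearMap.pi fun y => (MvPolynomial.aeval y.ofLp).toLinearMap

theorem polyFun_apply : polyFun p y = MvPolynomial.eval y.ofLp p := by
  simp [polyFun, MvPolynomial.aeval_eq_eval]

theorem lsFunctional_eq_norm_sq (hΦ : ∀ y ∈ X, 0 ≤ Φ ‖x - y‖) :
    lsFunctional Φ X x f p
      = ‖weightedSample Φ X x f - weightedSample Φ X x (polyFun p)‖ ^ 2 := by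
  rw [← map_sub, EuclideanSpace.norm_sq_eq, lsFunctional,
    ← Finset.sum_coe_sort X fun y => (f y - MvPolynomial.eval y.ofLp p) ^ 2 * Φ ‖x - y‖]
  refine Finset.sum_congr rfl fun y _ => ?_
  have happly : weightedSample Φ X x (f - polyFun p) y = √(Φ ‖x - y‖) * (f y - polyFun p y) := rfl
  rw [happly, polyFun_apply, Real.norm_eq_abs, sq_abs, mul_pow, Real.sq_sqrt (hΦ y y.2), mul_comm]

theorem isGMLSFit_iff_inner_eq_zero (hΦ : ∀ y ∈ X, 0 ≤ Φ ‖x - y‖) (hp : p ∈ polySpace m x) :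
    IsGMLSFit m Φ X x f p ↔ ∀ q ∈ polySpace m x,
      inner ℝ (weightedSample Φ X x f - weightedSample Φ X x (polyFun p))
        (weightedSample Φ X x (polyFun q)) = 0 := by
  set W := (polySubmodule m x).map (weightedSample Φ X x ∘ₗ polyFun)
  have hmem : ∀ {q}, q ∈ polySpace m x → weightedSample Φ X x (polyFun q) ∈ W :=
    fun hq => Submodule.mem_map_of_mem (mem_polySubmodule.2 hq)
  have hproj := W.norm_eq_iInf_iff_real_inner_eq_zero (u := weightedSample Φ X x f) (hmem hp)
  have hbdd : BddBelow (Set.range fun w : W => ‖weightedSample Φ X x f - w‖) :=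
    ⟨0, Set.forall_mem_range.2 fun _ => norm_nonneg _⟩
  simp only [IsGMLSFit, hp, true_and, lsFunctional_eq_norm_sq hΦ,
    pow_le_pow_iff_left₀ (norm_nonneg _) (norm_nonneg _) two_ne_zero]
  constructor
  · intro hmin q hq
    refine hproj.1 (le_antisymm (le_ciInf ?_) (ciInf_le hbdd ⟨_, hmem hp⟩)) _ (hmem hq)
    rintro ⟨_, r, hr, rfl⟩
    exact hmin r (mem_polySubmodule.1 hr)
  · intro horth q hq
    refine (hproj.2 ?_).trans_le (ciInf_le hbdd ⟨_, hmem hq⟩)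
    rintro _ ⟨r, hr, rfl⟩
    exact horth r (mem_polySubmodule.1 hr)

theorem exists_isGMLSFit (hΦ : ∀ y ∈ X, 0 ≤ Φ ‖x - y‖) : ∃ p, IsGMLSFit m Φ X x f p := by
  set W := (polySubmodule m x).map (weightedSample Φ X x ∘ₗ polyFun)
  obtain ⟨p, hp, hproj⟩ := W.starProjection_apply_mem (weightedSample Φ X x f)
  refine ⟨p, (isGMLSFit_iff_inner_eq_zero hΦ (mem_polySubmodule.1 hp)).2 fun q hq => ?_⟩
  rw [LinearMap.comp_apply] at hproj
  rw [hproj]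
  exact W.starProjection_inner_eq_zero _ _ (Submodule.mem_map_of_mem (mem_polySubmodule.2 hq))

theorem IsGMLSFit.lsFunctional_eq_add (hΦ : ∀ y ∈ X, 0 ≤ Φ ‖x - y‖) (hp : IsGMLSFit m Φ X x f p)
    (hq : q ∈ polySpace m x) :
    lsFunctional Φ X x f q = lsFunctional Φ X x f p + lsFunctional Φ X x (polyFun p) q := by
  have horth := (isGMLSFit_iff_inner_eq_zero hΦ hp.1).1 hp _ (sub_mem_polySpace hp.1 hq)
  rw [map_sub, map_sub] at horth
  rw [lsFunctional_eq_norm_sq hΦ, lsFunctional_eq_norm_sq hΦ, lsFunctional_eq_norm_sq hΦ,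
    ← sub_add_sub_cancel, sq, sq, sq, norm_add_sq_eq_norm_sq_add_norm_sq_real horth]

theorem IsGMLSFit.sq_eval_sub_mul_le (hΦ : ∀ y ∈ X, 0 ≤ Φ ‖x - y‖) (hp : IsGMLSFit m Φ X x f p)
    (hq : q ∈ polySpace m x) (hy : y ∈ X) :
    MvPolynomial.eval y.ofLp (p - q) ^ 2 * Φ ‖x - y‖
      ≤ lsFunctional Φ X x f q - lsFunctional Φ X x f p := by
  rw [hp.lsFunctional_eq_add hΦ hq, add_sub_cancel_left, map_sub]
  exact Finset.single_le_sum
    (f := fun y => (polyFun p y - MvPolynomial.eval y.ofLp q) ^ 2 * Φ ‖x - y‖)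
    (fun y hy => mul_nonneg (sq_nonneg _) (hΦ y hy)) hy

theorem existsUnique_isGMLSFit (hΦ : ∀ y ∈ X, 0 ≤ Φ ‖x - y‖)
    (hX : ∀ p ∈ polySpace m x,
      (∀ y ∈ X, 0 < Φ ‖x - y‖ → MvPolynomial.eval y.ofLp p = 0) → p = 0) :
    ∃! p, IsGMLSFit m Φ X x f p := by
  obtain ⟨p, hp⟩ := exists_isGMLSFit (m := m) (f := f) hΦ
  refine ⟨p, hp, fun q hq => sub_eq_zero.1 (hX _ (sub_mem_polySpace hq.1 hp.1) fun y hy hpos => ?_)⟩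
  have hle := hq.sq_eval_sub_mul_le hΦ hp.1 hy
  have hsq : MvPolynomial.eval y.ofLp (q - p) ^ 2 ≤ 0 :=
    nonpos_of_mul_nonpos_left (hle.trans (sub_nonpos.2 (hp.2 q hq.1))) hpos
  exact pow_eq_zero_iff two_ne_zero |>.1 (hsq.antisymm (sq_nonneg _))

theorem isGMLSFit_gmlsFit (h : ∃ p, IsGMLSFit m Φ X x f p) :
    IsGMLSFit m Φ X x f (gmlsFit m Φ X x f) := by
  rw [gmlsFit, dif_pos h]
  exact h.choose_spec

theorem lsFunctional_le_card_mul {δ B E : ℝ} (hΦ : ∀ y ∈ X, 0 ≤ Φ ‖x - y‖)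
    (hB : ∀ y ∈ X, Φ ‖x - y‖ ≤ B) (hsupp : ∀ t, δ < t → Φ t = 0)
    (hE : ∀ y ∈ Metric.closedBall x δ, |f y - MvPolynomial.eval y.ofLp p| ≤ E) :
    lsFunctional Φ X x f p ≤ (X.filter fun y => ‖x - y‖ ≤ δ).card * (E ^ 2 * B) := by
  rw [lsFunctional, ← Finset.sum_filter_of_ne (p := fun y => ‖x - y‖ ≤ δ), ← nsmul_eq_mul]
  · refine Finset.sum_le_card_nsmul _ _ _ fun y hy => ?_
    rw [Finset.mem_filter] at hy
    have hEy := hE y (by rw [mem_closedBall_iff_norm']; exact hy.2)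
    exact mul_le_mul (sq_le_sq.2 (hEy.trans (le_abs_self E))) (hB y hy.1) (hΦ y hy.1)
      (sq_nonneg E)
  · intro y _ hne
    contrapose! hne
    rw [hsupp _ hne, mul_zero]

theorem IsGMLSFit.abs_eval_sub_le {δ b B E : ℝ} {n : ℕ} (hp : IsGMLSFit m Φ X x f p)
    (hq : q ∈ polySpace m x) (hΦ : ∀ t, 0 ≤ t → 0 ≤ Φ t) (hB : ∀ t, 0 ≤ t → Φ t ≤ B)
    (hsupp : ∀ t, δ < t → Φ t = 0) (hn : (X.filter fun y => ‖x - y‖ ≤ δ).card ≤ n)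
    (hE₀ : 0 ≤ E) (hE : ∀ y ∈ Metric.closedBall x δ, |f y - MvPolynomial.eval y.ofLp q| ≤ E)
    (hb : 0 < b) (hy : y ∈ X) (hby : b ≤ Φ ‖x - y‖) :
    |MvPolynomial.eval y.ofLp (p - q)| ≤ √(n * B / b) * E := by
  have hΦX : ∀ y ∈ X, 0 ≤ Φ ‖x - y‖ := fun y _ => hΦ _ (norm_nonneg _)
  have hB₀ : 0 ≤ B := (hb.le.trans hby).trans (hB _ (norm_nonneg _))
  have hsq : MvPolynomial.eval y.ofLp (p - q) ^ 2 * b ≤ n * (E ^ 2 * B) := calc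
    _ ≤ MvPolynomial.eval y.ofLp (p - q) ^ 2 * Φ ‖x - y‖ := by gcongr
    _ ≤ lsFunctional Φ X x f q - lsFunctional Φ X x f p := hp.sq_eval_sub_mul_le hΦX hq hy
    _ ≤ lsFunctional Φ X x f q := sub_le_self _
      (Finset.sum_nonneg fun y hy => mul_nonneg (sq_nonneg _) (hΦX y hy))
    _ ≤ (X.filter fun y => ‖x - y‖ ≤ δ).card * (E ^ 2 * B) :=
      lsFunctional_le_card_mul hΦX (fun y _ => hB _ (norm_nonneg _)) hsupp hE
    _ ≤ n * (E ^ 2 * B) := by gcongr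
  refine abs_le_of_sq_le_sq ?_ (by positivity)
  rw [mul_pow, Real.sq_sqrt (by positivity), div_mul_eq_mul_div, le_div_iff₀ hb]
  linarith

end LeastSquares

section Weights

variable {φ : ℝ → ℝ} {δ : ℝ}

theorem IsWeightProfile.exists_bounds (hφ : IsWeightProfile φ) :
    ∃ b B : ℝ, 0 < b ∧ (∀ s, 0 ≤ s → s ≤ 1 / 4 → b ≤ φ s) ∧ ∀ s, 0 ≤ s → φ s ≤ B := by
  obtain ⟨s₀, hs₀, hmin⟩ := (isCompact_Icc (a := (0 : ℝ)) (b := 1 / 4)).exists_isMinOn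
    ⟨0, by norm_num⟩ (hφ.continuousOn.mono fun _ h => h.1)
  obtain ⟨s₁, hs₁, hmax⟩ := (isCompact_Icc (a := (0 : ℝ)) (b := 1)).exists_isMaxOn
    ⟨0, by norm_num⟩ (hφ.continuousOn.mono fun _ h => h.1)
  refine ⟨φ s₀, φ s₁, hφ.pos _ hs₀.1 (by linarith [hs₀.2]),
    fun s h0 h1 => hmin ⟨h0, h1⟩, fun s h0 => ?_⟩
  rcases le_or_gt s 1 with h1 | h1
  · exact hmax ⟨h0, h1⟩
  · exact (hφ.support s h1).trans_le (hφ.nonneg _ hs₁.1)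

theorem scaledWeight_nonneg (hφ : IsWeightProfile φ) (hδ : 0 < δ) {t : ℝ} (ht : 0 ≤ t) :
    0 ≤ scaledWeight φ δ t :=
  hφ.nonneg _ (by positivity)

theorem scaledWeight_eq_zero (hφ : IsWeightProfile φ) (hδ : 0 < δ) {t : ℝ} (ht : δ < t) :
    scaledWeight φ δ t = 0 :=
  hφ.support _ ((one_lt_div hδ).2 ht)

theorem scaledWeight_pos (hφ : IsWeightProfile φ) (hδ : 0 < δ) {t : ℝ} (ht : 0 ≤ t)
    (htδ : t ≤ δ / 4) : 0 < scaledWeight φ δ t :=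
  hφ.pos _ (by positivity) (by rw [div_lt_iff₀ hδ]; linarith)

end Weights

section ErrorEstimate

variable {d m : ℕ} {θ c r : ℝ} {Ω : Set (Pt d)} {X : Finset (Pt d)} {x : Pt d} {φ : ℝ → ℝ}

/-- The geometric situation of the error estimate: a bounded region `Ω` with the interior cone
property, a point `x` of it, and a point set `X` that is separated in proportion to its fill
distance and fine in comparison with the cones. -/
structure IsAdmissible (m : ℕ) (θ c r : ℝ) (Ω : Set (Pt d)) (X : Finset (Pt d)) (x : Pt d) :
    Prop where
  radius_pos : 0 < r
  isBounded : Bornology.IsBounded Ω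
  interiorCone : InteriorCone Ω r θ
  mem : x ∈ Ω
  nonempty : X.Nonempty
  fillDistance_le_separation : fillDistance X Ω ≤ c * separationDistance X
  fillDistance_le_radius : fillDistance X Ω ≤ r / coneConst m θ

theorem IsAdmissible.fillDistance_pos (hX : IsAdmissible m θ c r Ω X x) :
    0 < fillDistance X Ω :=
  StaggeredGMLS.fillDistance_pos hX.isBounded (hX.interiorCone.infinite hX.radius_pos hX.mem)
    hX.nonempty

theorem IsAdmissible.supportRadius_pos (hX : IsAdmissible m θ c r Ω X x) (hm : 0 < m)
    (hθ : 0 < Real.sin θ) : 0 < supportRadius m θ X Ω :=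
  mul_pos (mul_pos two_pos (coneConst_pos hm hθ)) hX.fillDistance_pos

theorem IsAdmissible.exists_norming_closedBall (hX : IsAdmissible m θ c r Ω X x) (hm : 0 < m)
    (hθ : 0 < Real.sin θ) :
    ∃ z : Pt d, ‖x - z‖ ≤ (Real.sin θ)⁻¹ * (normingRatio m θ * fillDistance X Ω) ∧
      ∀ (p : MvPolynomial (Fin d) ℝ) (B : ℝ), p.totalDegree ≤ m →
        (∀ y ∈ X, ‖x - y‖ ≤ supportRadius m θ X Ω / 4 → |MvPolynomial.eval y.ofLp p| ≤ B) →
        ∀ y ∈ Metric.closedBall z (normingRatio m θ * fillDistance X Ω),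
          |MvPolynomial.eval y.ofLp p| ≤ 2 * B :=
  hX.interiorCone.exists_norming_closedBall hm hθ hX.isBounded hX.mem hX.nonempty
    hX.fillDistance_pos hX.fillDistance_le_radius

theorem IsAdmissible.existsUnique_isGMLSFit (hX : IsAdmissible m θ c r Ω X x) (hm : 0 < m)
    (hθ : 0 < Real.sin θ) (hφ : IsWeightProfile φ) (f : Pt d → ℝ) :
    ∃! p, IsGMLSFit m (scaledWeight φ (supportRadius m θ X Ω)) X x f p := by
  have hδ := hX.supportRadius_pos hm hθ
  refine StaggeredGMLS.existsUnique_isGMLSFit (fun y _ => scaledWeight_nonneg hφ hδ (norm_nonneg _))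
    fun p hp hzero => ?_
  obtain ⟨z, -, hnorming⟩ := hX.exists_norming_closedBall hm hθ
  refine eq_zero_of_eval_closedBall (z := z) (mul_pos (normingRatio_pos hm hθ) hX.fillDistance_pos)
    fun y hy => ?_
  simpa using hnorming p 0 hp.1 (fun w hw hwx => by
    rw [hzero w hw (scaledWeight_pos hφ hδ (norm_nonneg _) hwx), abs_zero]) y hy

theorem exists_card_le (d m : ℕ) (θ c : ℝ) : ∃ n : ℕ, ∀ {r : ℝ} {Ω : Set (Pt d)}
    {X : Finset (Pt d)} {x : Pt d}, IsAdmissible m θ c r Ω X x →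
    (X.filter fun y => ‖x - y‖ ≤ supportRadius m θ X Ω).card ≤ n := by
  obtain ⟨n, hn⟩ := exists_card_le_of_subset_closedBall (E := Pt d) (2 * coneConst m θ)
    (s := 2 / max c 1) (by positivity)
  refine ⟨n, fun {r Ω X x} hX => hn _ x _ hX.fillDistance_pos (fun y hy => ?_)
    fun y hy z hz hyz => ?_⟩
  · rw [mem_closedBall_iff_norm']
    exact (Finset.mem_filter.1 hy).2
  · rw [div_mul_eq_mul_div, div_le_iff₀ (by positivity)]
    calc 2 * fillDistance X Ω ≤ 2 * (c * separationDistance X) := by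
          gcongr; exact hX.fillDistance_le_separation
      _ ≤ 2 * (max c 1 * separationDistance X) := by
          gcongr
          · exact separationDistance_nonneg X
          · exact le_max_left c 1
      _ = 2 * separationDistance X * max c 1 := by ring
      _ ≤ ‖y - z‖ * max c 1 := by
          gcongr
          exact two_mul_separationDistance_le (Finset.mem_of_mem_filter y hy)
            (Finset.mem_of_mem_filter z hz) hyz

theorem exists_abs_eval_sub_le (d : ℕ) (hm : 0 < m) (hθ : 0 < Real.sin θ) (c : ℝ)
    (hφ : IsWeightProfile φ) : ∃ G : ℝ, 0 ≤ G ∧ ∀ {r : ℝ} {Ω : Set (Pt d)} {X : Finset (Pt d)}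
    {x : Pt d}, IsAdmissible m θ c r Ω X x →
    ∀ {f : Pt d → ℝ} {p q : MvPolynomial (Fin d) ℝ} {E : ℝ},
      IsGMLSFit m (scaledWeight φ (supportRadius m θ X Ω)) X x f p → q ∈ polySpace m x →
      (∀ y ∈ Metric.closedBall x (supportRadius m θ X Ω),
        |f y - MvPolynomial.eval y.ofLp q| ≤ E) →
      ∀ y ∈ X, ‖x - y‖ ≤ supportRadius m θ X Ω / 4 →
        |MvPolynomial.eval y.ofLp (p - q)| ≤ G * E := by
  obtain ⟨n, hn⟩ := exists_card_le d m θ c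
  obtain ⟨b, B, hb, hφb, hφB⟩ := hφ.exists_bounds
  refine ⟨√(n * B / b), Real.sqrt_nonneg _, fun {r Ω X x} hX {f p q E} hp hq hE y hy hyx => ?_⟩
  have hδ := hX.supportRadius_pos hm hθ
  have hE₀ : 0 ≤ E := (abs_nonneg _).trans (hE x (Metric.mem_closedBall_self hδ.le))
  refine hp.abs_eval_sub_le hq (fun t ht => scaledWeight_nonneg hφ hδ ht)
    (fun t ht => hφB _ (by positivity)) (fun t ht => scaledWeight_eq_zero hφ hδ ht) (hn hX) hE₀ hE
    hb hy (hφb _ (by positivity) ?_)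
  rw [div_le_iff₀ hδ]
  linarith

theorem exists_pow_mul_abs_iterate_pderiv_sub_le (d : ℕ) (hm : 0 < m) (hθ : 0 < Real.sin θ) (c : ℝ)
    (hφ : IsWeightProfile φ) (n : ℕ) : ∃ D : ℝ, 0 ≤ D ∧ ∀ {r : ℝ} {Ω : Set (Pt d)}
    {X : Finset (Pt d)} {x : Pt d}, IsAdmissible m θ c r Ω X x →
    ∀ {f : Pt d → ℝ} {p q : MvPolynomial (Fin d) ℝ} {E : ℝ},
      IsGMLSFit m (scaledWeight φ (supportRadius m θ X Ω)) X x f p → q ∈ polySpace m x →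
      (∀ y ∈ Metric.closedBall x (supportRadius m θ X Ω),
        |f y - MvPolynomial.eval y.ofLp q| ≤ E) →
      ∀ k, fillDistance X Ω ^ n * |MvPolynomial.eval x.ofLp ((MvPolynomial.pderiv k)^[n] (p - q))|
        ≤ D * E := by
  obtain ⟨G, hG, hnodes⟩ := exists_abs_eval_sub_le d hm hθ c hφ
  have hκ := normingRatio_pos hm hθ
  set A := (Polynomial.derivative^[n] (Polynomial.Chebyshev.T ℝ m)).eval 1 *
    (Polynomial.Chebyshev.T ℝ m).eval ((Real.sin θ)⁻¹ + 1)
  refine ⟨|A| * (2 * G) / (normingRatio m θ / 2) ^ n, by positivity,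
    fun {r Ω X x} hX {f p q E} hp hq hE k => ?_⟩
  have hE₀ : 0 ≤ E := (abs_nonneg _).trans
    (hE x (Metric.mem_closedBall_self (hX.supportRadius_pos hm hθ).le))
  obtain ⟨z, hxz, hnorming⟩ := hX.exists_norming_closedBall hm hθ
  have hdeg : (p - q).totalDegree ≤ m := (sub_mem_polySpace hp.1 hq).1
  have hball := hnorming (p - q) (G * E) hdeg (hnodes hX hp hq hE)
  have hderiv := pow_mul_abs_eval_iterate_pderiv_le hdeg hball (inv_nonneg.2 hθ.le)
    (mul_pos hκ hX.fillDistance_pos).le hxz k n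
  rw [div_mul_eq_mul_div, le_div_iff₀ (by positivity)]
  calc _ = (normingRatio m θ * fillDistance X Ω / 2) ^ n * _ := by
        rw [mul_div_right_comm, mul_pow]
        ring
    _ ≤ A * (2 * (G * E)) := hderiv.trans_eq (mul_assoc _ _ _).symm
    _ ≤ |A| * (2 * (G * E)) := by gcongr; exact le_abs_self A
    _ = |A| * (2 * G) * E := by ring

theorem exists_abs_sub_iterate_pderiv_le (d : ℕ) (hm : 0 < m) (hθ : 0 < Real.sin θ) (c : ℝ)
    (hφ : IsWeightProfile φ) {j : ℕ} (hj : j ≤ m) : ∃ C : ℝ, 0 < C ∧ ∀ {r : ℝ} {Ω : Set (Pt d)}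
    {X : Finset (Pt d)} {x : Pt d}, IsAdmissible m θ c r Ω X x →
    ∀ {u : Pt d → Pt d} {N : ℝ} {p : MvPolynomial (Fin d) ℝ},
      ContDiffOn ℝ m u (Metric.closedBall x (supportRadius m θ X Ω)) →
      (∀ z ∈ Metric.closedBall x (supportRadius m θ X Ω),
        ‖iteratedFDerivWithin ℝ m u (Metric.closedBall x (supportRadius m θ X Ω)) z‖ ≤ N) →
      IsGMLSFit m (scaledWeight φ (supportRadius m θ X Ω)) X x (radialComponent u x) p →
      ∀ k, |2 * (j + 1) * iteratedFDerivWithin ℝ j u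
            (Metric.closedBall x (supportRadius m θ X Ω)) x (fun _ => EuclideanSpace.single k 1) k
          - MvPolynomial.eval x.ofLp ((MvPolynomial.pderiv k)^[j + 1] p)|
        ≤ C * fillDistance X Ω ^ (m - j) * N := by
  obtain ⟨D, hD, hstab⟩ := exists_pow_mul_abs_iterate_pderiv_sub_le d hm hθ c hφ (j + 1)
  have hK := coneConst_pos hm hθ
  refine ⟨D * (2 * (2 * coneConst m θ) ^ (m + 1)) + 2 * (j + 1), by positivity,
    fun {r Ω X x} hX {u N p} hu hN hp k => ?_⟩
  have hδ := hX.supportRadius_pos hm hθ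
  have hh := hX.fillDistance_pos
  set δ := supportRadius m θ X Ω with hδ_def
  set S := Metric.closedBall x δ
  have hxS : x ∈ S := Metric.mem_closedBall_self hδ.le
  have hN₀ : 0 ≤ N := (norm_nonneg _).trans (hN x hxS)
  rw [add_mul, add_mul]
  rcases hj.lt_or_eq with hjm | rfl
  · refine le_add_of_le_of_nonneg ?_ (by positivity)
    have hstab := hstab hX hp (radialTaylorPoly_mem_polySpace (S := S) (u := u))
      (fun y hy => abs_radialComponent_sub_radialTaylorPoly_le hm hδ hu hN hy) k
    rw [iterate_map_sub, map_sub, eval_iterate_pderiv_radialTaylorPoly hjm, abs_sub_comm] at hstab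
    refine le_of_mul_le_mul_left (hstab.trans_eq ?_) (pow_pos hh (j + 1))
    rw [hδ_def, supportRadius, mul_pow, show m + 1 = (j + 1) + (m - j) by omega, pow_add]
    ring
  · refine le_add_of_nonneg_of_le (by positivity) ?_
    rw [eval_iterate_pderiv_eq_zero (Nat.lt_succ_of_le hp.1.1), sub_zero, Nat.sub_self, pow_zero,
      mul_one, abs_mul, abs_of_nonneg (by positivity)]
    gcongr
    calc _ ≤ ‖iteratedFDerivWithin ℝ j u S x fun _ => EuclideanSpace.single k 1‖ :=
          PiLp.norm_apply_le _ k
      _ ≤ ‖iteratedFDerivWithin ℝ j u S x‖ :=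
          (ContinuousMultilinearMap.le_opNorm _ _).trans_eq (by simp)
      _ ≤ N := hN x hxS

theorem norm_le_sum_abs (v : Pt d) : ‖v‖ ≤ ∑ k, |v k| := by
  calc ‖v‖ = ‖∑ k, EuclideanSpace.single k (v k)‖ := by
        congr 1
        ext i
        simp [Pi.single_apply]
    _ ≤ ∑ k, ‖EuclideanSpace.single k (v k)‖ := norm_sum_le _ _
    _ = ∑ k, |v k| := by simp

theorem norm_sub_gmlsField_le {Φ : ℝ → ℝ} {u : Pt d → Pt d} {M : ℝ}
    (hM : ∀ k, |2 * u x k - MvPolynomial.eval x.ofLp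
      (MvPolynomial.pderiv k (gmlsFit m Φ X x (radialComponent u x)))| ≤ M) :
    ‖u x - gmlsField m Φ X x u‖ ≤ d * (M / 2) := by
  refine (norm_le_sum_abs _).trans ?_
  refine (Finset.sum_le_card_nsmul _ _ (M / 2) fun k _ => ?_).trans_eq (by simp)
  have hcoord : (u x - gmlsField m Φ X x u) k = (2 * u x k - MvPolynomial.eval x.ofLp
      (MvPolynomial.pderiv k (gmlsFit m Φ X x (radialComponent u x)))) / 2 := by
    simp only [gmlsField, gmlsGradient, PiLp.sub_apply, PiLp.smul_apply, smul_eq_mul]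
    ring
  rw [hcoord, abs_div, abs_two]
  linarith [hM k]

theorem abs_divergence_sub_gmlsDivergence_le {Φ : ℝ → ℝ} {u : Pt d → Pt d} {M : ℝ}
    (hM : ∀ k, |4 * (fderiv ℝ u x (EuclideanSpace.single k 1)) k - MvPolynomial.eval x.ofLp
      (MvPolynomial.pderiv k (MvPolynomial.pderiv k
        (gmlsFit m Φ X x (radialComponent u x))))| ≤ M) :
    |divergence u x - gmlsDivergence m Φ X x u| ≤ d * (M / 4) := by
  rw [divergence, gmlsDivergence, gmlsLaplacian, Finset.mul_sum, ← Finset.sum_sub_distrib]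
  refine (Finset.abs_sum_le_sum_abs _ _).trans ?_
  refine (Finset.sum_le_card_nsmul _ _ (M / 4) fun k _ => ?_).trans_eq (by simp)
  have hcoord : ∀ a b : ℝ, a - 1 / 4 * b = (4 * a - b) / 4 := fun a b => by ring
  rw [hcoord, abs_div, abs_of_pos (four_pos (α := ℝ))]
  linarith [hM k]

theorem exists_norm_sub_gmlsField_le (d : ℕ) (hm : 0 < m) (hθ : 0 < Real.sin θ) (c : ℝ)
    (hφ : IsWeightProfile φ) : ∃ C : ℝ, 0 ≤ C ∧ ∀ {r : ℝ} {Ω : Set (Pt d)} {X : Finset (Pt d)}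
    {x : Pt d}, IsAdmissible m θ c r Ω X x → ∀ {u : Pt d → Pt d} {N : ℝ},
      ContDiffOn ℝ m u (Metric.closedBall x (supportRadius m θ X Ω)) →
      (∀ z ∈ Metric.closedBall x (supportRadius m θ X Ω),
        ‖iteratedFDerivWithin ℝ m u (Metric.closedBall x (supportRadius m θ X Ω)) z‖ ≤ N) →
      ‖u x - gmlsField m (scaledWeight φ (supportRadius m θ X Ω)) X x u‖
        ≤ C * fillDistance X Ω ^ m * N := by
  obtain ⟨C, hC, hgradient⟩ := exists_abs_sub_iterate_pderiv_le d hm hθ c hφ (Nat.zero_le m)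
  refine ⟨d * (C / 2), by positivity, fun {r Ω X x} hX {u N} hu hN => ?_⟩
  have hfit := isGMLSFit_gmlsFit (hX.existsUnique_isGMLSFit hm hθ hφ (radialComponent u x)).exists
  refine (norm_sub_gmlsField_le fun k => ?_).trans_eq
    (show d * (C * fillDistance X Ω ^ m * N / 2) = _ by ring)
  simpa using hgradient hX hu hN hfit k

theorem exists_abs_divergence_sub_gmlsDivergence_le (d : ℕ) (hm : 0 < m) (hθ : 0 < Real.sin θ)
    (c : ℝ) (hφ : IsWeightProfile φ) : ∃ C : ℝ, 0 ≤ C ∧ ∀ {r : ℝ} {Ω : Set (Pt d)}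
    {X : Finset (Pt d)} {x : Pt d}, IsAdmissible m θ c r Ω X x → ∀ {u : Pt d → Pt d} {N : ℝ},
      ContDiffOn ℝ m u (Metric.closedBall x (supportRadius m θ X Ω)) →
      (∀ z ∈ Metric.closedBall x (supportRadius m θ X Ω),
        ‖iteratedFDerivWithin ℝ m u (Metric.closedBall x (supportRadius m θ X Ω)) z‖ ≤ N) →
      |divergence u x - gmlsDivergence m (scaledWeight φ (supportRadius m θ X Ω)) X x u|
        ≤ C * fillDistance X Ω ^ (m - 1) * N := by
  obtain ⟨C, hC, hlaplacian⟩ := exists_abs_sub_iterate_pderiv_le d hm hθ c hφ (j := 1) hm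
  refine ⟨d * (C / 4), by positivity, fun {r Ω X x} hX {u N} hu hN => ?_⟩
  have hfit := isGMLSFit_gmlsFit (hX.existsUnique_isGMLSFit hm hθ hφ (radialComponent u x)).exists
  refine (abs_divergence_sub_gmlsDivergence_le fun k => ?_).trans_eq
    (show d * (C * fillDistance X Ω ^ (m - 1) * N / 4) = _ by ring)
  rw [← iteratedFDerivWithin_one_closedBall (hX.supportRadius_pos hm hθ),
    show (4 : ℝ) = 2 * ((1 : ℕ) + 1) by norm_num]
  exact hlaplacian hX hu hN hfit k

end ErrorEstimate

end StaggeredGMLS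

theorem corollary3p4_general (d m : ℕ) (hm : 0 < m) (θ : ℝ) (hθ : 0 < θ) (hθ' : θ < Real.pi)
    (c : ℝ) (φ : ℝ → ℝ) (hφ : StaggeredGMLS.IsWeightProfile φ) :
    ∃ C : ℝ, 0 < C ∧
      ∀ {r : ℝ} {Ω : Set (StaggeredGMLS.Pt d)} {X : Finset (StaggeredGMLS.Pt d)}
        {x : StaggeredGMLS.Pt d} {δ : ℝ} {Φ : ℝ → ℝ},
      StaggeredGMLS.IsAdmissible m θ c r Ω X x →
      δ = StaggeredGMLS.supportRadius m θ X Ω →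
      Φ = StaggeredGMLS.scaledWeight φ δ →
      ∀ {u : StaggeredGMLS.Pt d → StaggeredGMLS.Pt d} {N : ℝ},
      ContDiffOn ℝ m u (Metric.closedBall x δ) →
      (∀ z ∈ Metric.closedBall x δ,
        ‖iteratedFDerivWithin ℝ m u (Metric.closedBall x δ) z‖ ≤ N) →
        (∃! p, StaggeredGMLS.IsGMLSFit m Φ X x (StaggeredGMLS.radialComponent u x) p) ∧
        ‖u x - StaggeredGMLS.gmlsField m Φ X x u‖
          ≤ C * StaggeredGMLS.fillDistance X Ω ^ m * N ∧
        |StaggeredGMLS.divergence u x - StaggeredGMLS.gmlsDivergence m Φ X x u|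
          ≤ C * StaggeredGMLS.fillDistance X Ω ^ (m - 1) * N := by
  have hsin := Real.sin_pos_of_pos_of_lt_pi hθ hθ'
  obtain ⟨C₀, hC₀, hfield⟩ := StaggeredGMLS.exists_norm_sub_gmlsField_le d hm hsin c hφ
  obtain ⟨C₁, hC₁, hdiv⟩ :=
    StaggeredGMLS.exists_abs_divergence_sub_gmlsDivergence_le d hm hsin c hφ
  refine ⟨C₀ + C₁ + 1, by positivity, ?_⟩
  rintro r Ω X x _ _ hX rfl rfl u N hu hN
  have hh := hX.fillDistance_pos
  have hN₀ : 0 ≤ N := (norm_nonneg _).trans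
    (hN x (Metric.mem_closedBall_self (hX.supportRadius_pos hm hsin).le))
  refine ⟨hX.existsUnique_isGMLSFit hm hsin hφ _, (hfield hX hu hN).trans ?_,
    (hdiv hX hu hN).trans ?_⟩ <;> gcongr <;> linarith

theorem corollary3p4 (d m : ℕ) (hm : 0 < m) (θ : ℝ) (hθ : 0 < θ) (hθ' : θ < Real.pi / 2)
    (c : ℝ) (φ : ℝ → ℝ) (hφ : StaggeredGMLS.IsWeightProfile φ) :
    ∃ C : ℝ, 0 < C ∧
      ∀ (Ω : Set (StaggeredGMLS.Pt d)) (r : ℝ), 0 < r → IsCompact Ω →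
      StaggeredGMLS.InteriorCone Ω r θ →
      ∀ (nodes : Finset (StaggeredGMLS.Pt d)) (ε : ℝ), 0 < ε →
      ∀ xi ∈ nodes, xi ∈ Ω →
      ∀ (X : Finset (StaggeredGMLS.Pt d)) (h δ : ℝ) (Φ : ℝ → ℝ)
        (Ωstar : Set (StaggeredGMLS.Pt d)),
      X = StaggeredGMLS.midpoints nodes ε xi →
      h = StaggeredGMLS.fillDistance X Ω →
      δ = StaggeredGMLS.supportRadius m θ X Ω →
      Φ = StaggeredGMLS.scaledWeight φ δ →
      Ωstar = Metric.closedBall xi δ →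
      StaggeredGMLS.QuasiUniform X Ω c →
      h ≤ r / StaggeredGMLS.coneConst m θ →
      ∀ u : StaggeredGMLS.Pt d → StaggeredGMLS.Pt d,
      ContDiffOn ℝ ((m + 1 : ℕ) : WithTop ℕ∞) u Ωstar →
        (∃! p, StaggeredGMLS.IsGMLSFit m Φ X xi (StaggeredGMLS.radialComponent u xi) p) ∧
        ‖u xi - StaggeredGMLS.gmlsField m Φ X xi u‖
          ≤ C * h ^ m * StaggeredGMLS.cNorm (m + 1) Ωstar u ∧
        |StaggeredGMLS.divergence u xi - StaggeredGMLS.gmlsDivergence m Φ X xi u|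
          ≤ C * h ^ (m - 1) * StaggeredGMLS.cNorm (m + 1) Ωstar u := by
  have hπ : θ < Real.pi := by linarith [Real.pi_pos]
  obtain ⟨C, hC, herror⟩ := corollary3p4_general d m hm θ hθ hπ c φ hφ
  refine ⟨C, hC, ?_⟩
  rintro Ω r hr hΩ hcone nodes ε - xi - hxi X _ δ Φ _ - rfl hδ hΦ rfl ⟨hne, -, hle⟩ hfine u hu
  have hX : StaggeredGMLS.IsAdmissible m θ c r Ω X xi :=
    ⟨hr, hΩ.isBounded, hcone, hxi, hne, hle, hfine⟩
  have hδ₀ : 0 < δ :=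
    hδ.symm ▸ hX.supportRadius_pos hm (Real.sin_pos_of_pos_of_lt_pi hθ hπ)
  exact herror hX hδ hΦ (hu.of_le (mod_cast m.le_succ)) fun z hz =>
    StaggeredGMLS.norm_iteratedFDerivWithin_le_cNorm (isCompact_closedBall _ _)
      (StaggeredGMLS.uniqueDiffOn_closedBall hδ₀) hu m.le_succ hz
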